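/- Let $d\neq 1$ be a square-free integer and let $K_d=\mathbb{Q}(\sqrt d)$. Let $n_d$ denote the number of rational primes that ramify in $K_d$, and let $h_d$ denote the class number of $K_d$, that is, the order of the ideal class group of its ring of integers. 1. If $n_d\ge 3$, then $h_d\ge 2$. In particular, if $n_d\ge 3$ and $h_d\le 2$, then $h_d=2$. 2. If $n_d\ge 4$, then $h_d\ge 4$. -/

import Mathlib

open NumberField

/-- A rational prime `p` ramifies in the number field `K` if some prime ideal of the ring of
integers of `K` lying above `p` has ramification index greater than `1`. -/
def IsRamifiedPrime (K : Type*) [Field K] [NumberField K] (p : ℕ) : Prop :=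
  p.Prime ∧ ∃ P : Ideal (𝓞 K), P.IsPrime ∧ P.LiesOver (Ideal.span {(p : ℤ)}) ∧
    1 < P.ramificationIdx ℤ

/-- The number of rational primes that ramify in `K`. (This set of primes is finite for every
number field.) -/
noncomputable def numRamifiedPrimes (K : Type*) [Field K] [NumberField K] : ℕ :=
  {p : ℕ | IsRamifiedPrime K p}.ncard

/-! Genus theory gives `2 ^ n ≤ 4 * h` for `n` ramified primes. For a set `S` of them, let `I S` be
the product of the primes above; its square is generated by a squarefree integer. If `I S` and `I
S₀` share a class, their quotient is generated by some `γ` whose square is a unit times a rational,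
so `ε = σ γ / γ` is a unit of relative norm one. If two such sets have `ε' = ε * w ^ 2` with `w` of
relative norm one, then `γ' * w / γ` is rational, so the norms of the two ideals agree up to squares
and the sets coincide. The unit group is cyclic torsion plus at most one generator, which leaves at
most four values of `ε` modulo squares, hence at most four sets per class. -/

/-- If a commutative group is generated by a cyclic subgroup and one more element, then each of its
subgroups has at most four classes modulo squares. -/
theorem exists_fourColoring_modSquares {G : Type*} [CommGroup G] (T : Subgroup G) [IsCyclic T]
    (g : G) (hg : ∀ x : G, ∃ t ∈ T, ∃ k : ℤ, x = t * g ^ k) (H : Subgroup G) :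
    ∃ c : H → ZMod 2 × ZMod 2, ∀ a b : H, c a = c b → ∃ w : H, a = b * w ^ 2 := by
  have hQ : IsCyclic (G ⧸ T) := ⟨QuotientGroup.mk g, fun q ↦ by
    obtain ⟨x, rfl⟩ := QuotientGroup.mk_surjective q
    obtain ⟨t, ht, k, rfl⟩ := hg x
    refine ⟨k, ?_⟩
    simp [(QuotientGroup.eq_one_iff t).2 ht]⟩
  -- `H` is an extension of its image in the cyclic group `G ⧸ T` by the cyclic group `H ⊓ T`, so
  -- lifts `η` and `t` of generators generate `H`.
  let f : H →* G ⧸ T := (QuotientGroup.mk' T).comp H.subtype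
  obtain ⟨⟨_, η, rfl⟩, hη⟩ := IsCyclic.exists_generator (α := f.range)
  obtain ⟨t, ht⟩ := ((H ⊓ T).isCyclic_iff_exists_zpowers_eq_top).1
    (Subgroup.isCyclic_of_le inf_le_right)
  have htH : t ∈ H := (ht ▸ Subgroup.mem_zpowers t : t ∈ H ⊓ T).1
  have key : ∀ a : H, ∃ ij : ℤ × ℤ, a = ⟨t, htH⟩ ^ ij.1 * η ^ ij.2 := by
    intro a
    obtain ⟨j, hj⟩ := hη ⟨f a, a, rfl⟩
    have hj' : f (η ^ j) = f a := by simpa using congrArg Subtype.val hj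
    have hmem : ((a * (η ^ j)⁻¹ : H) : G) ∈ H ⊓ T := by
      refine ⟨(a * (η ^ j)⁻¹).2, (QuotientGroup.eq_one_iff _).1 ?_⟩
      change f (a * (η ^ j)⁻¹) = 1
      rw [map_mul, map_inv, hj', mul_inv_cancel]
    rw [← ht] at hmem
    obtain ⟨i, hi⟩ := hmem
    refine ⟨(i, j), ?_⟩
    have : (⟨t, htH⟩ : H) ^ i = a * (η ^ j)⁻¹ := Subtype.ext (by simpa using hi)
    rw [this, inv_mul_cancel_right]
  choose e he using key
  -- The colour is the pair of exponent parities.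
  refine ⟨fun a ↦ ((e a).1, (e a).2), fun a b hab ↦ ?_⟩
  simp only [Prod.mk.injEq] at hab
  obtain ⟨h1, h2⟩ := hab
  obtain ⟨m, hm⟩ := (ZMod.intCast_eq_intCast_iff_dvd_sub _ _ 2).1 h1.symm
  obtain ⟨n, hn⟩ := (ZMod.intCast_eq_intCast_iff_dvd_sub _ _ 2).1 h2.symm
  refine ⟨⟨t, htH⟩ ^ m * η ^ n, ?_⟩
  have h1' : (e a).1 = (e b).1 + m * 2 := by push_cast at hm; linarith
  have h2' : (e a).2 = (e b).2 + n * 2 := by push_cast at hn; linarith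
  rw [he a, he b, h1', h2', mul_pow, zpow_add, zpow_add, zpow_mul, zpow_mul]
  simp only [zpow_ofNat]
  exact mul_mul_mul_comm _ _ _ _

theorem exists_unit_of_sq_eq_unit {K : Type*} [Field K] {z : K} {v : (𝓞 K)ˣ} (h : z ^ 2 = v) :
    ∃ ε : (𝓞 K)ˣ, (ε : K) = z := by
  have hv : ((v : (𝓞 K)ˣ) : K) * ((v⁻¹ : (𝓞 K)ˣ) : K) = 1 := by
    rw [← Units.coe_mul, mul_inv_cancel, Units.coe_one]
  have hz : IsIntegral ℤ z := IsIntegral.of_pow two_pos (h ▸ (v : 𝓞 K).2)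
  have hz' : IsIntegral ℤ (z * ((v⁻¹ : (𝓞 K)ˣ) : K)) := hz.mul ((v⁻¹ : (𝓞 K)ˣ) : 𝓞 K).2
  have hm : (⟨z, hz⟩ : 𝓞 K) * ⟨_, hz'⟩ = 1 := by
    apply RingOfIntegers.ext
    change z * (z * ((v⁻¹ : (𝓞 K)ˣ) : K)) = 1
    rw [← mul_assoc, ← pow_two, h, hv]
  exact ⟨Units.mkOfMulEqOne _ _ hm, rfl⟩

/-! ### Units and conjugation in a quadratic field -/

section Quadratic

variable {K : Type*} [Field K] [NumberField K]

theorem exists_unit_generating_modTorsion (h2 : Module.finrank ℚ K = 2) :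
    ∃ g : (𝓞 K)ˣ, ∀ u : (𝓞 K)ˣ, ∃ t ∈ Units.torsion K, ∃ k : ℤ, u = t * g ^ k := by
  -- From `r₁ + 2 r₂ = 2`, the unit rank `r₁ + r₂ - 1` is at most one.
  have hr : Units.rank K ≤ 1 := by
    have h := InfinitePlace.card_add_two_mul_card_eq_rank K
    rw [Units.rank, InfinitePlace.card_eq_nrRealPlaces_add_nrComplexPlaces]
    omega
  rcases Nat.le_one_iff_eq_zero_or_eq_one.1 hr with h0 | h1
  · refine ⟨1, fun u ↦ ?_⟩
    obtain ⟨⟨t, e⟩, hu, -⟩ := Units.exist_unique_eq_mul_prod K u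
    have : IsEmpty (Fin (Units.rank K)) := by rw [h0]; infer_instance
    exact ⟨t, t.2, 0, by simpa using hu⟩
  · let i : Fin (Units.rank K) := ⟨0, by omega⟩
    have : Unique (Fin (Units.rank K)) := ⟨⟨i⟩, fun j ↦ by ext; simp [i]; omega⟩
    refine ⟨Units.fundSystem K default, fun u ↦ ?_⟩
    obtain ⟨⟨t, e⟩, hu, -⟩ := Units.exist_unique_eq_mul_prod K u
    exact ⟨t, t.2, e default, by simpa using hu⟩

/-- The units `u` of the ring of integers with `σ u * u = 1`. -/
noncomputable def unitsConjInv (σ : K ≃ₐ[ℚ] K) : Subgroup (𝓞 K)ˣ :=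
  (Units.map (RingOfIntegers.mapRingHom (σ : K →+* K)).toMonoidHom * MonoidHom.id _).ker

theorem mem_unitsConjInv {σ : K ≃ₐ[ℚ] K} {u : (𝓞 K)ˣ} :
    u ∈ unitsConjInv σ ↔ σ (u : K) * (u : K) = 1 := by
  rw [unitsConjInv, MonoidHom.mem_ker, Units.ext_iff, RingOfIntegers.ext_iff]
  rfl

theorem exists_conj_of_finrank_eq_two (h2 : Module.finrank ℚ K = 2) :
    ∃ σ : K ≃ₐ[ℚ] K, (∀ z, σ (σ z) = z) ∧ ∀ z, σ z = z → ∃ r : ℚ, z = r := by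
  have : Algebra.IsQuadraticExtension ℚ K := ⟨h2⟩
  have hcard : Nat.card (K ≃ₐ[ℚ] K) = 2 := by rw [← h2, IsGalois.card_aut_eq_finrank]
  obtain ⟨σ, hσ⟩ := IsCyclic.exists_generator (α := K ≃ₐ[ℚ] K)
  refine ⟨σ, fun z ↦ ?_, fun z hz ↦ ?_⟩
  · have : σ ^ 2 = 1 := by rw [← hcard]; exact pow_card_eq_one'
    simpa [pow_two] using DFunLike.congr_fun this z
  · have : z ∈ (⊥ : IntermediateField ℚ K) := by
      refine (IsGalois.mem_bot_iff_fixed z).2 fun τ ↦ ?_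
      have : τ ∈ MulAction.stabilizer (K ≃ₐ[ℚ] K) z :=
        (Subgroup.zpowers_le.2 (show σ ∈ MulAction.stabilizer (K ≃ₐ[ℚ] K) z from hz)) (hσ τ)
      exact this
    obtain ⟨r, hr⟩ := IntermediateField.mem_bot.1 this
    exact ⟨r, by simp [← hr]⟩

/-- If the square of `γ` is a unit times a rational number, then `γ` and its conjugate differ by a
unit of relative norm one. -/
theorem exists_unitsConjInv_of_sq_eq {σ : K ≃ₐ[ℚ] K} (hσ : ∀ z, σ (σ z) = z) {γ : K} (hγ : γ ≠ 0)
    {u : (𝓞 K)ˣ} {q : ℚ} (h : γ ^ 2 = u * q) : ∃ ε ∈ unitsConjInv σ, σ γ = ε * γ := by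
  have hq : (q : K) ≠ 0 := by rintro hq; simp [hq, hγ] at h
  have hu : (u : K) ≠ 0 := by rintro hu; simp [hu, hγ] at h
  -- `v = σ u / u` is the square of `σ γ / γ`, since the rational factor cancels.
  let v : (𝓞 K)ˣ := Units.map (RingOfIntegers.mapRingHom (σ : K →+* K)).toMonoidHom u * u⁻¹
  have hv : (v : K) * u = σ u := by
    have : v * u = Units.map (RingOfIntegers.mapRingHom (σ : K →+* K)).toMonoidHom u :=
      inv_mul_cancel_right _ _
    rw [← Units.coe_mul, this]
    rfl
  have hsq : (σ γ / γ) ^ 2 = v := by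
    rw [div_pow, div_eq_iff (pow_ne_zero 2 hγ), ← map_pow, h, map_mul, ← hv, map_ratCast]
    ring
  obtain ⟨ε, hε⟩ := exists_unit_of_sq_eq_unit hsq
  refine ⟨ε, mem_unitsConjInv.2 ?_, ?_⟩
  · have hγ' : σ γ ≠ 0 := by simpa using hγ
    rw [hε, map_div₀, hσ]
    field_simp
  · rw [hε, div_mul_cancel₀ _ hγ]

/-- Since `σ w = w⁻¹`, the factor `w ^ 2` is absorbed and `γ' * w / γ` is fixed by `σ`. -/
theorem exists_rat_mul_of_conj {σ : K ≃ₐ[ℚ] K} (hfix : ∀ z, σ z = z → ∃ r : ℚ, z = r)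
    {γ γ' : K} (hγ : γ ≠ 0) {ε ε' w : (𝓞 K)ˣ} (hw : w ∈ unitsConjInv σ)
    (h : σ γ = ε * γ) (h' : σ γ' = ε' * γ') (hε : ε' = ε * w ^ 2) :
    ∃ r : ℚ, γ' * w = r * γ := by
  have hw' := mem_unitsConjInv.1 hw
  have hγ' : σ γ ≠ 0 := by simpa using hγ
  have hε0 : (ε : K) ≠ 0 := by rintro h0; simp [h0] at h; exact hγ h
  obtain ⟨r, hr⟩ := hfix (γ' * w / γ) (by
    rw [map_div₀, map_mul, h', h, hε]
    push_cast
    rw [div_eq_div_iff (mul_ne_zero hε0 hγ) hγ]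
    linear_combination (ε : K) * w * γ' * γ * hw')
  exact ⟨r, by rw [← hr, div_mul_cancel₀ _ hγ]⟩

/-! ### Ideals above ramified primes and their norms -/

theorem absNorm_span_natCast_of_finrank_eq_two (h2 : Module.finrank ℚ K = 2) (n : ℕ) :
    Ideal.absNorm (Ideal.span {(n : 𝓞 K)}) = n ^ 2 := by
  rw [Ideal.absNorm_span_singleton, ← map_natCast (algebraMap ℤ (𝓞 K)), Algebra.norm_algebraMap,
    RingOfIntegers.rank, h2]
  simp

/-- `P ^ 2` divides `(p)`, of norm `p ^ 2`; as `P` is proper, its norm is `p` and the cofactor is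
trivial. -/
theorem IsRamifiedPrime.exists_sq_eq_span (h2 : Module.finrank ℚ K = 2) {p : ℕ}
    (hp : IsRamifiedPrime K p) :
    ∃ P : Ideal (𝓞 K), P ^ 2 = Ideal.span {(p : 𝓞 K)} ∧ Ideal.absNorm P = p := by
  obtain ⟨hp, P, hP, hPp, hram⟩ := hp
  have hp0 : Ideal.span {(p : ℤ)} ≠ ⊥ := by simp [hp.ne_zero]
  rw [← Ideal.ramificationIdx'_eq_ramificationIdx (Ideal.span {(p : ℤ)}) P hp0] at hram
  have hle := Ideal.le_pow_of_le_ramificationIdx' (n := 2) hram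
  rw [Ideal.map_span, Set.image_singleton, ← Ideal.dvd_iff_le] at hle
  simp only [map_natCast] at hle
  obtain ⟨C, hC⟩ := hle
  have hN := congrArg Ideal.absNorm hC
  rw [absNorm_span_natCast_of_finrank_eq_two h2, map_mul, map_pow] at hN
  have hdvd : Ideal.absNorm P ∣ p := (Nat.pow_dvd_pow_iff two_ne_zero).1 ⟨_, hN⟩
  have hPN : Ideal.absNorm P = p := ((Nat.dvd_prime hp).1 hdvd).resolve_left fun h ↦
    hP.ne_top (Ideal.absNorm_eq_one_iff.1 h)
  refine ⟨P, ?_, hPN⟩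
  rw [hPN] at hN
  have hC1 : Ideal.absNorm C = 1 :=
    Nat.eq_of_mul_eq_mul_left (pow_pos hp.pos 2) (by rw [← hN, mul_one])
  rw [hC, Ideal.absNorm_eq_one_iff.1 hC1, Ideal.mul_top]

/-- Exponents in `m` and `n` are at most one and agree modulo two. -/
theorem Nat.eq_of_squarefree_of_sq_mul_eq {a b m n : ℕ} (hm : Squarefree m) (hn : Squarefree n)
    (ha : a ≠ 0) (hb : b ≠ 0) (h : a ^ 2 * m = b ^ 2 * n) : m = n := by
  have hm0 := hm.ne_zero
  have hn0 := hn.ne_zero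
  refine Nat.eq_of_factorization_eq hm0 hn0 fun p ↦ ?_
  have h1 := hm.natFactorization_le_one p
  have h2 := hn.natFactorization_le_one p
  have h3 := congrArg (fun k ↦ k.factorization p) h
  simp only [Nat.factorization_mul (pow_ne_zero 2 ha) hm0,
    Nat.factorization_mul (pow_ne_zero 2 hb) hn0, Nat.factorization_pow, Finsupp.add_apply,
    Finsupp.smul_apply, smul_eq_mul] at h3
  omega

/-- If two ideals become equal to principal multiples of a common ideal, by factors that agree up
to a unit and a rational number, then their norms agree up to rational squares. -/
theorem exists_sq_mul_absNorm_eq (h2 : Module.finrank ℚ K = 2) {I I' J : Ideal (𝓞 K)}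
    {x y x' y' : 𝓞 K} (hx : x ≠ 0) (hx' : x' ≠ 0) (hy' : y' ≠ 0)
    (h : Ideal.span {x} * I = Ideal.span {y} * J)
    (h' : Ideal.span {x'} * I' = Ideal.span {y'} * J) {w : (𝓞 K)ˣ} {r : ℚ}
    (hr : (y' / x' : K) * w = r * (y / x)) :
    ∃ a b : ℕ, a ≠ 0 ∧ b ≠ 0 ∧ a ^ 2 * Ideal.absNorm I' = b ^ 2 * Ideal.absNorm I := by
  have cx : (x : K) ≠ 0 := by simpa using hx
  have cx' : (x' : K) ≠ 0 := by simpa using hx'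
  have cy' : (y' : K) ≠ 0 := by simpa using hy'
  have cw : (w : K) ≠ 0 := by simp
  have hr0 : r ≠ 0 := by
    rintro rfl
    simp [cx', cy', cw] at hr
  have cd : (r.den : K) ≠ 0 := by simp
  have hrK : (r : K) = r.num / r.den := by
    conv_lhs => rw [← Rat.num_div_den r]
    push_cast; rfl
  have he : (r.den : 𝓞 K) * x * y' * w = (r.num : 𝓞 K) * x' * y := by
    apply RingOfIntegers.ext
    simp only [map_mul, map_natCast, map_intCast]
    rw [hrK] at hr
    field_simp at hr
    linear_combination hr
  have hnum : Ideal.span {(r.num : 𝓞 K)} = Ideal.span {(r.num.natAbs : 𝓞 K)} := by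
    rw [Ideal.span_singleton_eq_span_singleton]
    rcases Int.natAbs_eq r.num with hh | hh
    · conv_lhs => rw [hh]
      simp
    · conv_lhs => rw [hh]
      simp
  have hs := congrArg (fun t ↦ Ideal.span {t}) he
  simp only [← Ideal.span_singleton_mul_span_singleton,
    Ideal.span_singleton_eq_top.2 w.isUnit, Ideal.mul_top, hnum] at hs
  have hI : Ideal.span {(r.den : 𝓞 K)} * I' = Ideal.span {(r.num.natAbs : 𝓞 K)} * I := by
    have hx0 : Ideal.span {x} ≠ 0 := by simpa using hx
    have hx0' : Ideal.span {x'} ≠ 0 := by simpa using hx'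
    apply mul_left_cancel₀ (mul_ne_zero hx0 hx0')
    calc Ideal.span {x} * Ideal.span {x'} * (Ideal.span {(r.den : 𝓞 K)} * I')
        = Ideal.span {x} * Ideal.span {(r.den : 𝓞 K)} * (Ideal.span {x'} * I') := by ring
      _ = Ideal.span {(r.den : 𝓞 K)} * Ideal.span {x} * Ideal.span {y'} * J := by rw [h']; ring
      _ = Ideal.span {x'} * Ideal.span {(r.num.natAbs : 𝓞 K)} * (Ideal.span {y} * J) := by
        rw [hs]; ring
      _ = _ := by rw [← h]; ring
  refine ⟨r.den, r.num.natAbs, r.den_ne_zero, by simpa using hr0, ?_⟩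
  have := congrArg Ideal.absNorm hI
  simpa only [map_mul, absNorm_span_natCast_of_finrank_eq_two h2] using this

/-- Two nonzero elements `x`, `y` witnessing that ideals `I`, `J` with principal squares generated
by positive integers are equivalent have a quotient whose conjugate differs from it by a unit. -/
theorem exists_unitsConjInv_div {σ : K ≃ₐ[ℚ] K} (hσ : ∀ z, σ (σ z) = z) {I J : Ideal (𝓞 K)}
    {m n : ℕ} (hm : m ≠ 0) (hI : I ^ 2 = Ideal.span {(m : 𝓞 K)})
    (hJ : J ^ 2 = Ideal.span {(n : 𝓞 K)}) {x y : 𝓞 K} (hx : x ≠ 0) (hy : y ≠ 0)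
    (h : Ideal.span {x} * I = Ideal.span {y} * J) :
    ∃ ε ∈ unitsConjInv σ, σ (y / x) = ε * (y / x : K) := by
  have cx : (x : K) ≠ 0 := by simpa using hx
  have cy : (y : K) ≠ 0 := by simpa using hy
  have hs : Ideal.span {y ^ 2 * (n : 𝓞 K)} = Ideal.span {x ^ 2 * (m : 𝓞 K)} := by
    simp only [← Ideal.span_singleton_mul_span_singleton, ← Ideal.span_singleton_pow, ← hI, ← hJ,
      ← mul_pow, h]
  obtain ⟨u, hu⟩ := Ideal.span_singleton_eq_span_singleton.1 hs.symm
  have huK : (x : K) ^ 2 * m * u = (y : K) ^ 2 * n := by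
    simpa using congrArg (algebraMap (𝓞 K) K) hu
  have hn : (n : K) ≠ 0 := by
    intro hn
    simp [hn, cx, hm] at huK
  refine exists_unitsConjInv_of_sq_eq hσ (div_ne_zero cy cx) (u := u) (q := m / n) ?_
  push_cast
  field_simp
  linear_combination -huK

/-! ### Counting ideals in each class -/

/-- Each ideal class contains the product of the prime ideals above `S` for at most four sets `S`
of ramified primes, so that `n` ramified primes force `2 ^ n ≤ 4 * h`. -/
theorem two_pow_card_le_four_mul_classNumber (h2 : Module.finrank ℚ K = 2) (s : Finset ℕ)
    (hs : ∀ p ∈ s, IsRamifiedPrime K p) : 2 ^ s.card ≤ 4 * classNumber K := by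
  classical
  obtain ⟨σ, hσ, hfix⟩ := exists_conj_of_finrank_eq_two h2
  obtain ⟨g, hg⟩ := exists_unit_generating_modTorsion h2
  obtain ⟨c, hc⟩ := exists_fourColoring_modSquares (Units.torsion K) g hg (unitsConjInv σ)
  have hP : ∀ p, ∃ P : Ideal (𝓞 K),
      p ∈ s → P ^ 2 = Ideal.span {(p : 𝓞 K)} ∧ Ideal.absNorm P = p := fun p ↦ by
    by_cases hp : p ∈ s
    · obtain ⟨P, h⟩ := (hs p hp).exists_sq_eq_span h2
      exact ⟨P, fun _ ↦ h⟩
    · exact ⟨⊥, fun h ↦ absurd h hp⟩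
  choose P hP using hP
  let I : Finset ℕ → Ideal (𝓞 K) := fun S ↦ ∏ p ∈ S, P p
  have hprime : ∀ S ⊆ s, ∀ p ∈ S, p.Prime := fun S hS p hp ↦ (hs p (hS hp)).1
  have hne : ∀ S ⊆ s, ∏ p ∈ S, p ≠ 0 := fun S hS ↦
    Finset.prod_ne_zero_iff.2 fun p hp ↦ (hprime S hS p hp).ne_zero
  have hIsq : ∀ S ⊆ s, I S ^ 2 = Ideal.span {((∏ p ∈ S, p : ℕ) : 𝓞 K)} := fun S hS ↦ by
    rw [Nat.cast_prod, ← Ideal.prod_span_singleton, ← Finset.prod_pow]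
    exact Finset.prod_congr rfl fun p hp ↦ (hP p (hS hp)).1
  have hIN : ∀ S ⊆ s, Ideal.absNorm (I S) = ∏ p ∈ S, p := fun S hS ↦ by
    rw [map_prod]
    exact Finset.prod_congr rfl fun p hp ↦ (hP p (hS hp)).2
  have hI0 : ∀ S ⊆ s, I S ∈ nonZeroDivisors (Ideal (𝓞 K)) := fun S hS ↦ by
    rw [← Ideal.absNorm_ne_zero_iff_mem_nonZeroDivisors, hIN S hS]
    exact hne S hS
  let F : Finset ℕ → ClassGroup (𝓞 K) := fun S ↦
    if hS : S ⊆ s then ClassGroup.mk0 ⟨I S, hI0 S hS⟩ else 1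
  have hfibre : ∀ C ∈ (Finset.univ : Finset (ClassGroup (𝓞 K))),
      ({S ∈ s.powerset | F S = C} : Finset _).card ≤ 4 := by
    intro C _
    rcases ({S ∈ s.powerset | F S = C} : Finset _).eq_empty_or_nonempty with h | ⟨S₀, hmem⟩
    · simp [h]
    obtain ⟨hS₀, rfl⟩ := Finset.mem_filter.1 hmem
    rw [Finset.mem_powerset] at hS₀
    -- The witnesses are made total in `S` so that `choose` applies; outside the fibre they are
    -- junk.
    have hex : ∀ S, ∃ x y : 𝓞 K, ∃ ε : unitsConjInv σ, S ⊆ s → F S = F S₀ →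
        x ≠ 0 ∧ y ≠ 0 ∧ Ideal.span {x} * I S = Ideal.span {y} * I S₀ ∧
          σ (y / x) = ((ε : (𝓞 K)ˣ) : K) * (y / x : K) := by
      intro S
      by_cases h : S ⊆ s ∧ F S = F S₀
      · obtain ⟨hS, hF⟩ := h
        simp only [F, dif_pos hS, dif_pos hS₀] at hF
        obtain ⟨x, y, hx, hy, hxy⟩ := ClassGroup.mk0_eq_mk0_iff.1 hF
        obtain ⟨ε, hε, hε'⟩ := exists_unitsConjInv_div hσ (hne S hS) (hIsq S hS) (hIsq S₀ hS₀)
          hx hy hxy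
        exact ⟨x, y, ⟨ε, hε⟩, fun _ _ ↦ ⟨hx, hy, hxy, hε'⟩⟩
      · exact ⟨0, 0, 1, fun h1 h3 ↦ absurd ⟨h1, h3⟩ h⟩
    choose x y ε hxy using hex
    refine (Finset.card_le_card_of_injOn (t := (Finset.univ : Finset (ZMod 2 × ZMod 2)))
      (fun S ↦ c (ε S)) (fun _ _ ↦ Finset.mem_univ _) ?_).trans (by simp)
    intro S hS S' hS' hcc
    simp only [Finset.coe_filter, Finset.mem_powerset, Set.mem_ofPred_eq] at hS hS'
    obtain ⟨hx, hy, hI, hε⟩ := hxy S hS.1 hS.2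
    obtain ⟨hx', hy', hI', hε'⟩ := hxy S' hS'.1 hS'.2
    obtain ⟨w, hw⟩ := hc _ _ hcc.symm
    have hyx : (y S / x S : K) ≠ 0 := div_ne_zero (by simpa using hy) (by simpa using hx)
    obtain ⟨r, hr⟩ := exists_rat_mul_of_conj hfix hyx w.2 hε hε' (congrArg Subtype.val hw)
    obtain ⟨a, b, ha, hb, hab⟩ := exists_sq_mul_absNorm_eq h2 hx hx' hy' hI hI' hr
    have hsqf : ∀ S ⊆ s, Squarefree (∏ p ∈ S, p) := fun S hS ↦
      Finset.squarefree_prod_of_pairwise_isCoprime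
        (fun p hp q hq hpq ↦ Nat.coprime_iff_isRelPrime.1
          ((Nat.coprime_primes (hprime S hS p hp) (hprime S hS q hq)).2 hpq))
        (fun p hp ↦ (hprime S hS p hp).prime.squarefree)
    rw [hIN S hS.1, hIN S' hS'.1] at hab
    -- A set of primes is recovered as the prime factors of its product.
    rw [← Nat.primeFactors_prod (hprime S hS.1), ← Nat.primeFactors_prod (hprime S' hS'.1),
      Nat.eq_of_squarefree_of_sq_mul_eq (hsqf S' hS'.1) (hsqf S hS.1) ha hb hab]
  have := Finset.card_le_mul_card_image_of_maps_to (f := F) (s := s.powerset)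
    (fun _ _ ↦ Finset.mem_univ _) 4 hfibre
  rwa [Finset.card_powerset, Finset.card_univ] at this

theorem two_pow_le_four_mul_classNumber (h2 : Module.finrank ℚ K = 2) {n : ℕ} (hn : n ≠ 0)
    (h : n ≤ numRamifiedPrimes K) : 2 ^ n ≤ 4 * classNumber K := by
  have hfin : {p : ℕ | IsRamifiedPrime K p}.Finite :=
    Set.finite_of_ncard_pos ((Nat.pos_of_ne_zero hn).trans_le h)
  refine (Nat.pow_le_pow_right two_pos h).trans ?_
  rw [numRamifiedPrimes, Set.ncard_eq_toFinset_card _ hfin]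
  exact two_pow_card_le_four_mul_classNumber h2 _ fun p hp ↦ by simpa using hp

theorem finrank_eq_two_of_sq_eq_squarefree {d : ℤ} (hd : Squarefree d) (hd1 : d ≠ 1) {x : K}
    (hx : x ^ 2 = (d : K)) (hK : IntermediateField.adjoin ℚ {x} = ⊤) :
    Module.finrank ℚ K = 2 := by
  have hnsq : ∀ r : ℚ, (d : ℚ) ≠ r ^ 2 := by
    intro r hr
    have : IsSquare ((d : ℤ) : ℚ) := ⟨r, by rw [hr, pow_two]⟩
    obtain ⟨e, rfl⟩ := Rat.isSquare_intCast_iff.1 this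
    rcases Int.isUnit_iff.1 (hd e dvd_rfl) with rfl | rfl <;> simp at hd1
  have hirr : Irreducible (Polynomial.X ^ 2 - Polynomial.C (d : ℚ)) :=
    X_pow_sub_C_irreducible_of_prime Nat.prime_two fun r hr ↦ hnsq r hr.symm
  have hmin := minpoly.eq_of_irreducible_of_monic hirr (x := x) (by simp [hx])
    (Polynomial.monic_X_pow_sub_C _ two_ne_zero)
  have hint : IsIntegral ℚ x := Algebra.IsIntegral.isIntegral x
  rw [← IntermediateField.finrank_top', ← hK, IntermediateField.adjoin.finrank hint, ← hmin,
    Polynomial.natDegree_X_pow_sub_C]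

end Quadratic

/-- `K` is any model of the quadratic field `ℚ(√d)`, with `x` a square root of `d`. -/
theorem mainTheorem2 (d : ℤ) (hd : Squarefree d) (hd1 : d ≠ 1)
    (K : Type*) [Field K] [NumberField K]
    (x : K) (hx : x ^ 2 = (d : K)) (hK : IntermediateField.adjoin ℚ {x} = ⊤) :
    (3 ≤ numRamifiedPrimes K → 2 ≤ classNumber K) ∧
    (3 ≤ numRamifiedPrimes K → classNumber K ≤ 2 → classNumber K = 2) ∧
    (4 ≤ numRamifiedPrimes K → 4 ≤ classNumber K) := by
  have h2 := finrank_eq_two_of_sq_eq_squarefree hd hd1 hx hK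
  have h3 : 3 ≤ numRamifiedPrimes K → 2 ≤ classNumber K := fun h ↦ by
    have := two_pow_le_four_mul_classNumber h2 three_ne_zero h
    omega
  refine ⟨h3, fun h hle ↦ le_antisymm hle (h3 h), fun h ↦ ?_⟩
  have := two_pow_le_four_mul_classNumber h2 four_ne_zero h
  omega
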